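/- For integers $k,\ell\ge 0$ let $$c_{k,\ell}=(-1)^{k+\ell}\binom{k+\ell}{k}-\frac{(-1)^{\ell}\binom{k+\ell}{k}+(-1)^{k+\ell}(\ell+1)}{k+\ell+2},$$ and define real numbers $b_{k,\ell}$ recursively by $b_{k,\ell}=(k+1)\,(x_{k-1,\ell}+y_{k-1,\ell}-c_{k+1,\ell})$, where $$x_{k,\ell}=\sum_{\substack{i,j\ge 0\\ i+j\le k}}\frac{b_{i,k-i-j}\,b_{j,\ell}}{(i+1)(i+j+2)},\qquad y_{k,\ell}=\sum_{i=0}^{k}(-1)^{k-i}\frac{b_{i,\ell}}{i+1},\qquad x_{-1,\ell}=y_{-1,\ell}=0.$$ Let $B(x,P)=\sum_{k=0}^\infty\sum_{\ell=0}^\infty b_{k,\ell}\,x^kP^\ell$. Let (H) be the conjecture that (i) the double power series $B(x,P)$ converges (absolutely, as is usual for power series in several variables) for $0\le x<\frac12$, $x\le P\le\frac12$; (ii) $B(x,P)\ge 0$ for $0\le x<\frac12$, $x\le P\le\frac12$; (iii) $\int_0^P B(x,P)\,dx=\frac1{P+1}-\sqrt{\frac{1-2P}{1+2P}}$ for $0\le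 P\le\frac12$. **Theorem.** Assume that (H) is true. Then the following hold. (a) For all $0\le p_1<p_2<\dots<p_n\le 1$ there is a probability distribution over the symmetric group $S_n$ such that, for all $1\le i<j\le n$, $$\Pr_\pi[\pi(i)<\pi(j)]=\min\Bigl(1,\frac1{p_i+p_j}\Bigr).$$ (b) There is an absolute constant $C>0$ such that the following holds. Let $n\ge 2$, let $0\le p_1<p_2<\dots<p_n\le 1$ be the fractions of blue balls in $n$ urns that contain only blue and red balls, and let $\epsilon=\min_{1\le i\le n-1}(p_{i+1}-p_i)$. One of the urns, unknown to the voters, is on the table. Each of $m$ voters independently draws (with replacement) one ball from it, and then returns a ranking of all $n$ urns, chosen by a randomized rule that depends only on the color of her ball and is the same for all voters (a symmetric voting scheme). Urn $i$ wins the Condorcet election if, for every $j\ne i$, more than half of the voters rank $i$ higher than $j$. There is a symmetric voting scheme, depending only on $p_1,\dots,p_n$, such that for every $0<\eta\le\frac12$, every number $m\ge C\,\epsilon^{-2}\ln\frac1\eta$ of voters, and whichever urn is the unknown one, the unknown urn wins the Condorcet election with probability at least $1-\eta$. In particular, $O(\epsilon^{-2}\ln\frac1\eta)$ voters suffice. 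-/

import Mathlib

open scoped BigOperators

noncomputable section

namespace Condorcet

/-! ### The coefficients, the power series and the conjecture -/

/-- The numbers `c_{k,ℓ}`. -/
def c (k l : ℕ) : ℝ :=
  (-1) ^ (k + l) * ((k + l).choose k : ℝ)
    - ((-1) ^ l * ((k + l).choose k : ℝ) + (-1) ^ (k + l) * ((l : ℝ) + 1)) / ((k : ℝ) + l + 2)

/-- The numbers `b_{k,ℓ}`, for `k, ℓ ≥ 0`. In the equation for `k + 1`, the double sum runs over all
`i, j ≥ 0` with `i + j ≤ k`; it is `x_{k,ℓ}` below, and the single sum is `y_{k,ℓ}` below. -/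
def b : ℕ → ℕ → ℝ
  | 0, l => -c 1 l
  | k + 1, l =>
    ((k : ℝ) + 2) *
      ((∑ i : Fin (k + 1), ∑ j : Fin (k + 1 - i.val),
          b i.val (k - i.val - j.val) * b j.val l
            / (((i.val : ℝ) + 1) * ((i.val : ℝ) + (j.val : ℝ) + 2)))
        + (∑ i : Fin (k + 1), (-1) ^ (k - i.val) * (b i.val l / ((i.val : ℝ) + 1)))
        - c (k + 2) l)
termination_by k l => k + l
decreasing_by all_goals omega

/-- `x_{k,ℓ} = ∑_{i, j ≥ 0, i + j ≤ k} b_{i,k-i-j} b_{j,ℓ} / ((i + 1) (i + j + 2))`. -/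
def x (k l : ℕ) : ℝ :=
  ∑ i ∈ Finset.range (k + 1), ∑ j ∈ Finset.range (k + 1 - i),
    b i (k - i - j) * b j l / (((i : ℝ) + 1) * ((i : ℝ) + (j : ℝ) + 2))

/-- `y_{k,ℓ} = ∑_{0 ≤ i ≤ k} (-1)^{k-i} b_{i,ℓ} / (i + 1)`. -/
def y (k l : ℕ) : ℝ :=
  ∑ i ∈ Finset.range (k + 1), (-1) ^ (k - i) * (b i l / ((i : ℝ) + 1))

/-- The defining recurrence `b_{k,ℓ} = (k + 1) (x_{k-1,ℓ} + y_{k-1,ℓ} - c_{k+1,ℓ})` at `k = 0`, where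
`x_{-1,ℓ} = y_{-1,ℓ} = 0` (empty sums). -/
theorem b_zero (l : ℕ) : b 0 l = -c 1 l := by
  rw [b]

/-- The defining recurrence `b_{k,ℓ} = (k + 1) (x_{k-1,ℓ} + y_{k-1,ℓ} - c_{k+1,ℓ})` at positive
first index. -/
theorem b_succ (k l : ℕ) :
    b (k + 1) l = ((k : ℝ) + 2) * (x k l + y k l - c (k + 2) l) := by
  rw [b, x, y, Finset.sum_range, Finset.sum_range]
  simp only [Finset.sum_range]

/-- The term of index `(k, ℓ)` of the double power series `B(X, P)`. -/
def term (X P : ℝ) (kl : ℕ × ℕ) : ℝ :=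
  b kl.1 kl.2 * X ^ kl.1 * P ^ kl.2

/-- `B(X, P) = ∑_{k, ℓ ≥ 0} b_{k,ℓ} X^k P^ℓ`. -/
def B (X P : ℝ) : ℝ :=
  ∑' kl : ℕ × ℕ, term X P kl

/-- The conjecture on the power series `B`: (i) it converges (absolutely, as is usual for power
series in several variables), (ii) its sum is nonnegative, both for `0 ≤ X < 1/2` and
`X ≤ P ≤ 1/2`, and (iii) its integral in the first variable has the given value. -/
def Conjecture : Prop :=
  (∀ X P : ℝ, 0 ≤ X → X < 1 / 2 → X ≤ P → P ≤ 1 / 2 → Summable (term X P)) ∧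
  (∀ X P : ℝ, 0 ≤ X → X < 1 / 2 → X ≤ P → P ≤ 1 / 2 → 0 ≤ B X P) ∧
  (∀ P : ℝ, 0 ≤ P → P ≤ 1 / 2 →
    ∫ X in (0 : ℝ)..P, B X P = 1 / (P + 1) - √((1 - 2 * P) / (1 + 2 * P)))

/-! ### Bichromatic urns and Condorcet elections -/

/-- The two colors of the balls. -/
inductive Color
  | blue
  | red

/-- The color of a ball drawn from an urn whose fraction of blue balls is `q`. -/
def drawBall (q : unitInterval) : PMF Color :=
  ⟨fun col => match col with
    | Color.blue => ENNReal.ofReal (q : ℝ)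
    | Color.red => ENNReal.ofReal (1 - (q : ℝ)), by
    let e : Bool ≃ Color :=
      ⟨fun t => if t then Color.blue else Color.red,
        fun col => match col with | Color.blue => true | Color.red => false,
        fun t => by cases t <;> rfl, fun col => by cases col <;> rfl⟩
    rw [← e.hasSum_iff]
    have h2 := hasSum_fintype (fun t : Bool =>
      if t then ENNReal.ofReal (q : ℝ) else ENNReal.ofReal (1 - (q : ℝ)))
    have h3 : (∑ t : Bool,
        if t then ENNReal.ofReal (q : ℝ) else ENNReal.ofReal (1 - (q : ℝ))) = 1 := by
      rw [Fintype.sum_bool]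
      simp only [if_true, Bool.false_eq_true, if_false]
      rw [← ENNReal.ofReal_add q.2.1 (sub_nonneg.2 q.2.2)]
      simp
    rw [h3] at h2
    convert h2 using 1
    funext t
    cases t <;> rfl⟩

/-- A ballot: a total ordering of the `n` candidates, given by the rank `π i` of each candidate `i`.
Candidate `i` is ranked higher than candidate `j` if `π j < π i`. -/
abbrev Ballot (n : ℕ) : Type := Equiv.Perm (Fin n)

instance (n : ℕ) : MeasurableSpace (Ballot n) := ⊤

/-- A symmetric voting scheme: one randomized rule, used by every voter, from the color of the ball
that the voter drew to her ballot. -/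
abbrev SymmetricScheme (n : ℕ) : Type := Color → PMF (Ballot n)

/-- The law of one voter's ballot: she draws a ball from the unknown urn, which has a fraction `q`
of blue balls, and applies the scheme to its color. -/
def ballotLaw {n : ℕ} (σ : SymmetricScheme n) (q : unitInterval) : PMF (Ballot n) :=
  (drawBall q).bind σ

/-- The law of the ballots of `m` independent voters. -/
def electionLaw {n : ℕ} (σ : SymmetricScheme n) (q : unitInterval) (m : ℕ) :
    MeasureTheory.Measure (Fin m → Ballot n) :=
  MeasureTheory.Measure.pi (fun _ => (ballotLaw σ q).toMeasure)

/-- Candidate `i` beats candidate `j` in the run-off: more than half of the `m` voters ranked `i`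
higher than `j`. -/
def Beats {n m : ℕ} (v : Fin m → Ballot n) (i j : Fin n) : Prop :=
  (m : ℝ) / 2 < ((Finset.univ.filter (fun t : Fin m => v t j < v t i)).card : ℝ)

/-- Candidate `i` wins the Condorcet election: it beats each other candidate in a run-off. -/
def IsWinner {n m : ℕ} (v : Fin m → Ballot n) (i : Fin n) : Prop :=
  ∀ j : Fin n, j ≠ i → Beats v i j

/-- `ε` is the minimum of the gaps `p_{i+1} - p_i`. In particular, there are at least two urns. -/
def IsMinGap {n : ℕ} (p : Fin n → unitInterval) (ε : ℝ) : Prop :=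
  IsLeast {d : ℝ | ∃ i j : Fin n, i.val + 1 = j.val ∧ d = (p j : ℝ) - (p i : ℝ)} ε

end Condorcet

end

/-!
The urns are ranked by independent random positions on the real line, sorted with ties broken by
the index. The urn `p ≤ 1/2` has the position `p - 1/2`. The urn `1/2 + Q`, `Q > 0`, has the
density `1 / (1 + Q + s) ^ 2` at `s ∈ (-Q, 0]`, which is what the comparison with the urns
`p ≤ 1/2` requires, the density `B(s, Q)` at `s ∈ (0, Q)`, and the remaining mass as an atom at `Q`. By
part (ii) of the conjecture the density is nonnegative, and by part (iii) the atom has the mass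
`√((1 - 2Q) / (1 + 2Q)) ≥ 0`, so that this is a probability law (`isProbabilityMeasure_upperLaw`).

For two urns `1/2 + P < 1/2 + Q` the probability of the wrong order has to be
`(P + Q) / (1 + P + Q)`. After an integration by parts this is an integral equation for `B`. Comparing its
coefficients at `P ^ (k + 1) Q ^ ℓ` gives precisely the recurrence for `b_{k,ℓ}`: the products of
two values of `B` give `x_{k-1,ℓ}`, the division by `1 + P` gives `y_{k-1,ℓ}`, and the part
without `B` gives `c_{k+1,ℓ}` (`hasSum_x`, `hasSum_y`, `hasSum_c`). As all series converge
absolutely, by part (i), the recurrence implies the integral equation (`balance_equation`), and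
hence the first claim.

For the second claim, a voter with a blue ball ranks the urns according to this distribution, and
a voter with a red ball according to the one for the fractions of red balls. Two urns then get
equal support if the unknown fraction lies halfway between theirs, and the unknown urn `u` is
preferred to `j` with probability at least `1/2 + |p u - p j| / 4` (`exists_scheme`). Since
`|p u - p j| ≥ |u - j| ε`, Hoeffding's inequality bounds the probability that `u` does not beat `j` by
`η ^ (3 |u - j|)`, and the union bound over `j` is a geometric series (`one_sub_le_isWinner`).
-/

namespace Condorcet

open MeasureTheory ProbabilityTheory

/-! ### Absolutely convergent families of monomials -/

theorem hasSum_of_eq {α : Type*} {F G : α → ℝ} {S : ℝ} (hF : HasSum F S)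
    (h : ∀ a, G a = F a) : HasSum G S := by
  rwa [funext h]

/-- In `ℝ`, convergent sums converge absolutely, so that they may be multiplied. -/
theorem hasSum_mul_prod {α β : Type*} {F : α → ℝ} {G : β → ℝ} {S T : ℝ} (hF : HasSum F S)
    (hG : HasSum G T) : HasSum (fun p : α × β => F p.1 * G p.2) (S * T) :=
  hF.mul hG (summable_mul_of_summable_norm hF.summable.norm hG.summable.norm)

/-- A convergent sum may be regrouped along a map `g` with finite fibres `s`. -/
theorem hasSum_sum_fibers {α β : Type*} {F : α → ℝ} {S : ℝ} (hF : HasSum F S) (g : α → β)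
    (s : β → Finset α) (hs : ∀ a q, a ∈ s q ↔ g a = q) :
    HasSum (fun q => ∑ a ∈ s q, F a) S := by
  have h := hF.tsum_fiberwise g
  have hset : ∀ q, (g ⁻¹' {q}) = (↑(s q) : Set α) := by
    intro q
    ext a
    simp [hs]
  refine hasSum_of_eq h fun q => ?_
  rw [hset]
  exact (Finset.tsum_subtype' (s q) F).symm

theorem summable_monomial_of_le {ι : Type*} {a : ι → ℝ} {n : ι → ℕ} {R t : ℝ}
    (hs : Summable fun i => |a i| * R ^ n i) (h0 : 0 ≤ t) (ht : t ≤ R) :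
    Summable fun i => a i * t ^ n i := by
  refine Summable.of_norm_bounded hs fun i => ?_
  rw [norm_mul, norm_pow, Real.norm_eq_abs, Real.norm_eq_abs, abs_of_nonneg h0]
  gcongr

theorem continuousOn_tsum_monomial {ι : Type*} {a : ι → ℝ} {n : ι → ℕ} {R : ℝ}
    (hs : Summable fun i => |a i| * R ^ n i) :
    ContinuousOn (fun t : ℝ => ∑' i, a i * t ^ n i) (Set.Icc 0 R) := by
  refine continuousOn_tsum (fun i => by fun_prop) hs fun i t ht => ?_
  rw [norm_mul, norm_pow, Real.norm_eq_abs, Real.norm_eq_abs, abs_of_nonneg ht.1]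
  have h0 := ht.1
  have hR := ht.2
  gcongr

/-- An absolutely convergent family of monomials may be integrated term by term. -/
theorem hasSum_integral_monomial {ι : Type*} [Countable ι] {a : ι → ℝ} {n : ι → ℕ} {R : ℝ}
    (hR : 0 ≤ R) (hs : Summable fun i => |a i| * R ^ n i) :
    HasSum (fun i => a i * (R ^ (n i + 1) / ((n i : ℝ) + 1)))
      (∫ t in (0 : ℝ)..R, ∑' i, a i * t ^ n i) := by
  have h := intervalIntegral.hasSum_integral_of_dominated_convergence (μ := volume)
    (a := 0) (b := R) (F := fun i t => a i * t ^ n i) (f := fun t => ∑' i, a i * t ^ n i)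
    (fun i _ => |a i| * R ^ n i) (fun i => by fun_prop)
    (fun i => Filter.Eventually.of_forall fun t ht => by
      rw [Set.uIoc_of_le hR] at ht
      rw [norm_mul, norm_pow, Real.norm_eq_abs, Real.norm_eq_abs, abs_of_pos ht.1]
      gcongr
      exacts [ht.1.le, ht.2])
    (Filter.Eventually.of_forall fun t _ => hs) intervalIntegrable_const
    (Filter.Eventually.of_forall fun t ht => by
      rw [Set.uIoc_of_le hR] at ht
      exact (summable_monomial_of_le hs ht.1.le ht.2).hasSum)
  refine hasSum_of_eq h fun i => ?_
  rw [intervalIntegral.integral_const_mul, integral_pow]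
  simp

theorem summable_choose_mul_pow_of_nonneg {u v : ℝ} (hu : 0 ≤ u) (hv : 0 ≤ v) (h : u + v < 1) :
    Summable fun q : ℕ × ℕ => ((q.1 + q.2).choose q.1 : ℝ) * u ^ q.1 * v ^ q.2 := by
  rw [← Finset.HasAntidiagonal.sigmaAntidiagonalEquivProd.summable_iff]
  rw [summable_sigma_of_nonneg (fun _ => by dsimp; positivity)]
  refine ⟨fun n => (hasSum_fintype _).summable, ?_⟩
  have h2 : Summable fun n : ℕ => (u + v) ^ n :=
    summable_geometric_of_lt_one (by positivity) h
  refine h2.congr fun n => ?_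
  rw [tsum_fintype, Finset.univ_eq_attach, (Commute.all u v).add_pow',
    ← Finset.sum_attach (Finset.HasAntidiagonal.antidiagonal n)]
  refine Finset.sum_congr rfl fun q _ => ?_
  have hq : q.1.1 + q.1.2 = n := Finset.HasAntidiagonal.mem_antidiagonal.1 q.2
  simp [hq, mul_assoc]

theorem summable_choose_mul_pow {u v : ℝ} (h : |u| + |v| < 1) :
    Summable fun q : ℕ × ℕ => ((q.1 + q.2).choose q.1 : ℝ) * u ^ q.1 * v ^ q.2 := by
  refine Summable.of_norm_bounded
    (summable_choose_mul_pow_of_nonneg (abs_nonneg u) (abs_nonneg v) h) fun q => ?_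
  simp

theorem hasSum_choose_mul_pow {u v : ℝ} (h : |u| + |v| < 1) :
    HasSum (fun q : ℕ × ℕ => ((q.1 + q.2).choose q.1 : ℝ) * u ^ q.1 * v ^ q.2)
      (1 / (1 - u - v)) := by
  have h1 := (summable_choose_mul_pow h).hasSum
  have h2 := hasSum_sum_fibers h1 (fun q => q.1 + q.2) Finset.HasAntidiagonal.antidiagonal
    (fun q n => Finset.HasAntidiagonal.mem_antidiagonal)
  have h3 : HasSum (fun n : ℕ => (u + v) ^ n) (1 - (u + v))⁻¹ :=
    hasSum_geometric_of_abs_lt_one ((abs_add_le u v).trans_lt h)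
  have h4 : (∑' q : ℕ × ℕ, ((q.1 + q.2).choose q.1 : ℝ) * u ^ q.1 * v ^ q.2)
      = 1 / (1 - u - v) := by
    rw [one_div, sub_sub]
    refine (h2.unique ?_)
    convert h3 using 2 with n
    rw [(Commute.all u v).add_pow']
    refine Finset.sum_congr rfl fun q hq => ?_
    have hq : q.1 + q.2 = n := Finset.HasAntidiagonal.mem_antidiagonal.1 hq
    simp [hq, mul_assoc]
  rwa [h4] at h1

theorem hasSum_neg_pow_mul_succ {u v : ℝ} (hu : |u| < 1) (hv : |v| < 1) :
    HasSum (fun q : ℕ × ℕ => (-1) ^ (q.1 + q.2) * ((q.2 : ℝ) + 1) * u ^ q.1 * v ^ q.2)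
      (1 / ((1 + u) * (1 + v) ^ 2)) := by
  have h1 : HasSum (fun n : ℕ => (-u) ^ n) (1 - -u)⁻¹ :=
    hasSum_geometric_of_abs_lt_one (by rwa [abs_neg])
  have h2 := hasSum_choose_mul_geometric_of_norm_lt_one (𝕜 := ℝ) 1 (r := -v)
    (by rwa [norm_neg])
  have h3 := hasSum_mul_prod h1 h2
  have h4 : (1 - -u)⁻¹ * (1 / (1 - -v) ^ (1 + 1)) = 1 / ((1 + u) * (1 + v) ^ 2) := by
    rw [sub_neg_eq_add, sub_neg_eq_add, ← one_div, div_mul_div_comm, one_mul]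
  rw [h4] at h3
  refine hasSum_of_eq h3 fun q => ?_
  simp only [Nat.choose_one_right]
  push_cast
  rw [neg_pow u, neg_pow v]
  ring

/-! ### The generating function of the numbers `c_{k,ℓ}` -/

/-- The term of index `(k, ℓ)` of `∑ (k + ℓ + 2) d_{k,ℓ} P^k Q^ℓ`, where `d_{k,ℓ}` is the fraction
that is subtracted in the definition of `c_{k,ℓ}`. Its denominator `k + ℓ + 2` comes from an
integration along the ray through `(P, Q)`. -/
noncomputable def cNumerator (P Q : ℝ) (q : ℕ × ℕ) : ℝ :=
  ((-1) ^ q.2 * ((q.1 + q.2).choose q.1 : ℝ) + (-1) ^ (q.1 + q.2) * ((q.2 : ℝ) + 1))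
    * P ^ q.1 * Q ^ q.2

theorem hasSum_cNumerator {P Q r : ℝ} (hP : 0 ≤ P) (hQ : 0 ≤ Q) (hPQ : P + Q < 1)
    (hr : 0 ≤ r) (hr1 : r ≤ 1) :
    HasSum (fun q => cNumerator P Q q * r ^ (q.1 + q.2 + 1))
      (r / (1 + r * (Q - P)) + r / ((1 + r * P) * (1 + r * Q) ^ 2)) := by
  have hrP : r * P ≤ P := mul_le_of_le_one_left hP hr1
  have hrQ : r * Q ≤ Q := mul_le_of_le_one_left hQ hr1
  have hrP0 : 0 ≤ r * P := by positivity
  have hrQ0 : 0 ≤ r * Q := by positivity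
  have h1 := hasSum_choose_mul_pow (u := r * P) (v := -(r * Q))
    (by rw [abs_neg, abs_of_nonneg hrP0, abs_of_nonneg hrQ0]; linarith)
  have h2 := hasSum_neg_pow_mul_succ (u := r * P) (v := r * Q)
    (by rw [abs_of_nonneg hrP0]; linarith) (by rw [abs_of_nonneg hrQ0]; linarith)
  have h3 := (h1.add h2).mul_left r
  have h4 : r * (1 / (1 - r * P - -(r * Q)) + 1 / ((1 + r * P) * (1 + r * Q) ^ 2))
      = r / (1 + r * (Q - P)) + r / ((1 + r * P) * (1 + r * Q) ^ 2) := by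
    rw [mul_add, mul_one_div, mul_one_div]
    congr 2
    ring
  rw [h4] at h3
  refine hasSum_of_eq h3 fun q => ?_
  simp only [cNumerator, neg_pow (r * Q), mul_pow]
  ring

/-- By partial fractions. The logarithms are those of `integral_sq_inv_mul_one_sub`, so that they
cancel in `hasSum_c`. -/
theorem integral_cNumerator {P Q : ℝ} (hP : 0 ≤ P) (hPQ : P < Q) (hQ1 : P + Q < 1) :
    (∫ r in (0 : ℝ)..1, (r / (1 + r * (Q - P)) + r / ((1 + r * P) * (1 + r * Q) ^ 2)))
      = 1 / (Q - P) - 1 / ((Q - P) * (1 + Q))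
        - (Real.log (1 + (Q - P)) + Real.log (1 + P) - Real.log (1 + Q)) / (Q - P) ^ 2 := by
  have hD : 0 < Q - P := sub_pos.2 hPQ
  set D := Q - P with hDdef
  have hQ : Q = P + D := by rw [hDdef]; ring
  clear_value D
  subst hQ
  have hDQ : 0 < (P + D) := by linarith
  have hpos : ∀ r ∈ Set.uIcc (0 : ℝ) 1, 0 < 1 + r * D ∧ 0 < 1 + r * P ∧ 0 < 1 + r * (P + D) := by
    intro r hr
    rw [Set.uIcc_of_le zero_le_one] at hr
    have := hr.1
    refine ⟨by positivity, by positivity, by positivity⟩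
  have hderiv : ∀ r ∈ Set.uIcc (0 : ℝ) 1, HasDerivAt
      (fun r => r / D
        - (Real.log (1 + r * D) + Real.log (1 + r * P) - Real.log (1 + r * (P + D))) / D ^ 2
        + (1 / (D * (P + D))) * (1 + r * (P + D))⁻¹)
      (r / (1 + r * D) + r / ((1 + r * P) * (1 + r * (P + D)) ^ 2)) r := by
    intro r hr
    obtain ⟨a1, a2, a3⟩ := hpos r hr
    have l : ∀ s : ℝ, HasDerivAt (fun r => 1 + r * s) s r := fun s => by
      simpa using ((hasDerivAt_id r).mul_const s).const_add 1
    have e := (((hasDerivAt_id r).div_const D).sub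
      ((((l D).log a1.ne').add ((l P).log a2.ne')).sub ((l (P + D)).log a3.ne')
        |>.div_const (D ^ 2))).add
      (((l (P + D)).fun_inv a3.ne').const_mul (1 / (D * (P + D))))
    refine e.congr_deriv ?_
    have := a1.ne'; have := a2.ne'; have := a3.ne'; have := hD.ne'; have := hDQ.ne'
    have f1 : r / (1 + r * D) = 1 / D - D / (1 + r * D) / D ^ 2 := by
      field_simp
      ring
    have f2 : r / ((1 + r * P) * (1 + r * (P + D)) ^ 2)
        = (-(P / (1 + r * P)) + (P + D) / (1 + r * (P + D))) / D ^ 2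
          + 1 / (D * (P + D)) * (-(P + D) / (1 + r * (P + D)) ^ 2) := by
      field_simp
      ring
    rw [f1, f2]
    ring
  rw [intervalIntegral.integral_eq_sub_of_hasDerivAt hderiv]
  · have : 1 + (P + D) ≠ 0 := by positivity
    have := hD.ne'; have := hDQ.ne'
    simp only [one_mul, zero_mul, add_zero, Real.log_one]
    field_simp
    ring
  · refine ContinuousOn.intervalIntegrable ?_
    refine ContinuousOn.add (ContinuousOn.div (by fun_prop) (by fun_prop) ?_)
      (ContinuousOn.div (by fun_prop) (by fun_prop) ?_)
    · exact fun r hr => (hpos r hr).1.ne'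
    · exact fun r hr => (mul_pos (hpos r hr).2.1 (pow_pos (hpos r hr).2.2 2)).ne'

theorem integral_sq_inv_mul_one_sub {P Q : ℝ} (hP : 0 ≤ P) (hPQ : P < Q) :
    (∫ t in (0 : ℝ)..P, 1 / (1 + P - t) ^ 2 * ((Q - t) / (1 + Q - t)))
      = 1 - 1 / (1 + P) - (1 / (Q - P)) * (1 - 1 / (1 + P))
        + (Real.log (1 + (Q - P)) + Real.log (1 + P) - Real.log (1 + Q)) / (Q - P) ^ 2 := by
  have hD : 0 < Q - P := sub_pos.2 hPQ
  set D := Q - P with hDdef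
  have hQ : Q = P + D := by rw [hDdef]; ring
  clear_value D
  subst hQ
  have hpos : ∀ t ∈ Set.uIcc (0 : ℝ) P, 0 < 1 + P - t ∧ 0 < 1 + (P + D) - t := by
    intro t ht
    rw [Set.uIcc_of_le hP] at ht
    have := ht.2
    exact ⟨by linarith, by linarith⟩
  have hderiv : ∀ t ∈ Set.uIcc (0 : ℝ) P, HasDerivAt
      (fun t => (1 - 1 / D) * (1 + P - t)⁻¹
        + (Real.log (1 + (P + D) - t) - Real.log (1 + P - t)) / D ^ 2)
      (1 / (1 + P - t) ^ 2 * (((P + D) - t) / (1 + (P + D) - t))) t := by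
    intro t ht
    obtain ⟨a1, a2⟩ := hpos t ht
    have l : ∀ s : ℝ, HasDerivAt (fun r => 1 + s - r) (-1) t := fun s => by
      simpa using (hasDerivAt_id t).const_sub (1 + s)
    have e := (((l P).fun_inv a1.ne').const_mul (1 - 1 / D)).add
      ((((l (P + D)).log a2.ne').sub ((l P).log a1.ne')).div_const (D ^ 2))
    refine e.congr_deriv ?_
    have := a1.ne'; have := a2.ne'; have := hD.ne'
    field_simp
    ring
  rw [intervalIntegral.integral_eq_sub_of_hasDerivAt hderiv]
  · have : 1 + P ≠ 0 := by positivity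
    have e1 : 1 + P - P = 1 := by ring
    have e2 : 1 + (P + D) - P = 1 + D := by ring
    simp only [sub_zero, e1, e2, Real.log_one]
    field_simp
    ring
  · refine ContinuousOn.intervalIntegrable ?_
    refine ContinuousOn.mul (ContinuousOn.div (by fun_prop) (by fun_prop) ?_)
      (ContinuousOn.div (by fun_prop) (by fun_prop) ?_)
    · exact fun r hr => (pow_pos (hpos r hr).1 2).ne'
    · exact fun r hr => (hpos r hr).2.ne'

/-- The numbers `c_{k,ℓ}` are the power series coefficients of the part of the balance equation
that does not involve the density `B`. -/
theorem hasSum_c {P Q : ℝ} (hP : 0 ≤ P) (hPQ : P < Q) (hQ1 : P + Q < 1) :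
    HasSum (fun q : ℕ × ℕ => c q.1 q.2 * P ^ q.1 * Q ^ q.2)
      (1 / (1 + P) * (Q / (1 + Q))
        + (∫ t in (0 : ℝ)..P, 1 / (1 + P - t) ^ 2 * ((Q - t) / (1 + Q - t)))
        - (P + Q) / (1 + P + Q)) := by
  have hQ : 0 < Q := hP.trans_lt hPQ
  have h1 := hasSum_choose_mul_pow (u := -P) (v := -Q)
    (by rw [abs_neg, abs_neg, abs_of_nonneg hP, abs_of_pos hQ]; exact hQ1)
  have hs : Summable fun q : ℕ × ℕ => |cNumerator P Q q| * (1 : ℝ) ^ (q.1 + q.2 + 1) := by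
    have := (hasSum_cNumerator hP hQ.le hQ1 zero_le_one le_rfl).summable.abs
    simpa using this
  have h2 := hasSum_integral_monomial zero_le_one hs
  have h3 : (∫ r in (0 : ℝ)..1, ∑' q, cNumerator P Q q * r ^ (q.1 + q.2 + 1))
      = ∫ r in (0 : ℝ)..1, (r / (1 + r * (Q - P)) + r / ((1 + r * P) * (1 + r * Q) ^ 2)) := by
    refine intervalIntegral.integral_congr fun r hr => ?_
    rw [Set.uIcc_of_le zero_le_one] at hr
    exact (hasSum_cNumerator hP hQ.le hQ1 hr.1 hr.2).tsum_eq
  rw [h3, integral_cNumerator hP hPQ hQ1] at h2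
  have h4 := h1.sub h2
  rw [integral_sq_inv_mul_one_sub hP hPQ]
  have hD : Q - P ≠ 0 := (sub_pos.2 hPQ).ne'
  have n1 : 1 + P ≠ 0 := by positivity
  have n2 : 1 + Q ≠ 0 := by positivity
  have n3 : 1 + P + Q ≠ 0 := by positivity
  have h5 : 1 / (1 - -P - -Q) - (1 / (Q - P) - 1 / ((Q - P) * (1 + Q))
        - (Real.log (1 + (Q - P)) + Real.log (1 + P) - Real.log (1 + Q)) / (Q - P) ^ 2)
      = 1 / (1 + P) * (Q / (1 + Q))
        + (1 - 1 / (1 + P) - (1 / (Q - P)) * (1 - 1 / (1 + P))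
        + (Real.log (1 + (Q - P)) + Real.log (1 + P) - Real.log (1 + Q)) / (Q - P) ^ 2)
        - (P + Q) / (1 + P + Q) := by
    rw [sub_neg_eq_add, sub_neg_eq_add]
    generalize (Real.log (1 + (Q - P)) + Real.log (1 + P) - Real.log (1 + Q)) / (Q - P) ^ 2 = w
    field_simp
    ring
  rw [h5] at h4
  refine hasSum_of_eq h4 fun q => ?_
  have : (q.1 : ℝ) + q.2 + 2 ≠ 0 := by positivity
  simp only [c, cNumerator, neg_pow P, neg_pow Q, one_pow]
  push_cast
  rw [show (q.1 : ℝ) + q.2 + 1 + 1 = q.1 + q.2 + 2 by ring]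
  ring

theorem c_zero_left (l : ℕ) : c 0 l = 0 := by
  have : (l : ℝ) + 2 ≠ 0 := by positivity
  simp only [c, zero_add, Nat.choose_zero_right, Nat.cast_zero, Nat.cast_one]
  field_simp
  ring

/-! ### The balance equation for the density `B` -/

theorem B_eq_tsum_monomial (t Q : ℝ) :
    B t Q = ∑' q : ℕ × ℕ, (b q.1 q.2 * Q ^ q.2) * t ^ q.1 := by
  unfold B term
  exact tsum_congr fun q => by ring

theorem summable_abs_of_term {R Q : ℝ} (hR : 0 ≤ R) (h : Summable (term R Q)) :
    Summable fun q : ℕ × ℕ => |b q.1 q.2 * Q ^ q.2| * R ^ q.1 := by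
  refine h.abs.congr fun q => ?_
  simp only [term, abs_mul, abs_pow, abs_of_nonneg hR]
  ring

theorem continuousOn_B {R Q : ℝ} (hR : 0 ≤ R) (h : Summable (term R Q)) :
    ContinuousOn (fun t => B t Q) (Set.Icc 0 R) := by
  simp only [B_eq_tsum_monomial]
  exact continuousOn_tsum_monomial (summable_abs_of_term hR h)

theorem hasSum_B {R Q t : ℝ} (h : Summable (term R Q)) (ht : 0 ≤ t) (htR : t ≤ R) :
    HasSum (fun q : ℕ × ℕ => (b q.1 q.2 * Q ^ q.2) * t ^ q.1) (B t Q) := by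
  rw [B_eq_tsum_monomial]
  exact (summable_monomial_of_le (summable_abs_of_term (ht.trans htR) h) ht htR).hasSum

theorem hasSum_integral_B {R Q t : ℝ} (h : Summable (term R Q)) (ht : 0 ≤ t) (htR : t ≤ R) :
    HasSum (fun q : ℕ × ℕ => (b q.1 q.2 * Q ^ q.2) * (t ^ (q.1 + 1) / ((q.1 : ℝ) + 1)))
      (∫ s in (0 : ℝ)..t, B s Q) := by
  simp only [B_eq_tsum_monomial]
  refine hasSum_integral_monomial ht ?_
  refine (summable_abs_of_term (ht.trans htR) h).of_nonneg_of_le (fun q => by positivity)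
    fun q => ?_
  gcongr

/-- A double series may be shifted by one in its first index if its terms at `k = 0` vanish. -/
theorem hasSum_shift_iff {F : ℕ × ℕ → ℝ} {S : ℝ} (h0 : ∀ l, F (0, l) = 0) :
    HasSum (fun q : ℕ × ℕ => F (q.1 + 1, q.2)) S ↔ HasSum F S := by
  have hinj : Function.Injective fun q : ℕ × ℕ => (q.1 + 1, q.2) := by
    rintro ⟨k, l⟩ ⟨k', l'⟩ h
    simpa using h
  refine hinj.hasSum_iff (f := F) ?_
  rintro ⟨k, l⟩ hk
  cases k with
  | zero => exact h0 l
  | succ k => exact absurd ⟨(k, l), rfl⟩ hk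

/-- The generating function of `y_{k,ℓ}` is a Cauchy product with a geometric series. -/
theorem hasSum_y {P Q : ℝ} (hP : 0 ≤ P) (hP1 : P < 1) (h : Summable (term P Q)) :
    HasSum (fun q : ℕ × ℕ => y q.1 q.2 * P ^ (q.1 + 1) * Q ^ q.2)
      ((∫ s in (0 : ℝ)..P, B s Q) / (1 + P)) := by
  have h1 := hasSum_integral_B h hP le_rfl
  have h2 : HasSum (fun n : ℕ => (-P) ^ n) (1 - -P)⁻¹ :=
    hasSum_geometric_of_abs_lt_one (by rwa [abs_neg, abs_of_nonneg hP])
  have h3 := hasSum_mul_prod h1 h2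
  rw [sub_neg_eq_add, ← div_eq_mul_inv] at h3
  have h4 := hasSum_sum_fibers h3 (fun p : (ℕ × ℕ) × ℕ => (p.1.1 + p.2, p.1.2))
    (fun q => (Finset.range (q.1 + 1)).image fun i => ((i, q.2), q.1 - i)) (by
      rintro ⟨⟨i, l⟩, r⟩ ⟨k, l'⟩
      simp only [Finset.mem_image, Finset.mem_range, Prod.mk.injEq]
      constructor
      · rintro ⟨i', h1, ⟨rfl, rfl⟩, rfl⟩
        exact ⟨by omega, rfl⟩
      · rintro ⟨rfl, rfl⟩
        exact ⟨i, by omega, ⟨rfl, rfl⟩, by omega⟩)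
  refine hasSum_of_eq h4 fun q => ?_
  rw [Finset.sum_image (by intro i _ j _ hij; simpa using congrArg (fun p => p.1.1) hij), y,
    Finset.sum_mul, Finset.sum_mul]
  refine Finset.sum_congr rfl fun i hi => ?_
  have hi : i ≤ q.1 := Nat.lt_succ_iff.1 (Finset.mem_range.1 hi)
  have hp : P ^ (q.1 + 1) = P ^ (i + 1) * P ^ (q.1 - i) := by
    rw [← pow_add]
    congr 1
    omega
  rw [hp, neg_pow P]
  ring

/-- A sum over quadruples `((i, m), (j, ℓ))`, regrouped according to `i + m + j` and `ℓ`. -/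
theorem hasSum_regroup {F : (ℕ × ℕ) × (ℕ × ℕ) → ℝ} {S : ℝ} (hF : HasSum F S) :
    HasSum (fun q : ℕ × ℕ => ∑ i ∈ Finset.range (q.1 + 1), ∑ j ∈ Finset.range (q.1 + 1 - i),
      F ((i, q.1 - i - j), (j, q.2))) S := by
  have h := hasSum_sum_fibers hF
    (fun p : (ℕ × ℕ) × (ℕ × ℕ) => (p.1.1 + p.1.2 + p.2.1, p.2.2))
    (fun q => ((Finset.range (q.1 + 1)).sigma fun i => Finset.range (q.1 + 1 - i)).image
      fun a => ((a.1, q.1 - a.1 - a.2), (a.2, q.2))) (by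
      rintro ⟨⟨i, m⟩, ⟨j, l⟩⟩ ⟨k, l'⟩
      simp only [Finset.mem_image, Finset.mem_sigma, Finset.mem_range, Prod.mk.injEq]
      constructor
      · rintro ⟨⟨i', j'⟩, ⟨h1, h2⟩, ⟨rfl, rfl⟩, rfl, rfl⟩
        dsimp at *
        exact ⟨by omega, rfl⟩
      · rintro ⟨rfl, rfl⟩
        exact ⟨⟨i, j⟩, ⟨by dsimp; omega, by dsimp; omega⟩, ⟨rfl, by dsimp; omega⟩, rfl, rfl⟩)
  refine hasSum_of_eq h fun q => ?_
  rw [Finset.sum_image, Finset.sum_sigma]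
  rintro ⟨i, j⟩ _ ⟨i', j'⟩ _ hij
  simp only [Prod.mk.injEq] at hij
  obtain ⟨⟨rfl, _⟩, rfl, _⟩ := hij
  rfl

/-- The generating function of `x_{k,ℓ}`: by parts, the right-hand side is the integral over
`0 ≤ t ≤ P` of `B t Q * ∫ s in 0..t, B s P`. -/
theorem hasSum_x {P Q : ℝ} (hP : 0 ≤ P) (hPP : Summable (term P P)) (hPQ : Summable (term P Q)) :
    HasSum (fun q : ℕ × ℕ => x q.1 q.2 * P ^ (q.1 + 2) * Q ^ q.2)
      ((∫ t in (0 : ℝ)..P, B t P) * (∫ t in (0 : ℝ)..P, B t Q)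
        - ∫ t in (0 : ℝ)..P, B t P * ∫ s in (0 : ℝ)..t, B s Q) := by
  -- the coefficients of `B t P * ∫ s in 0..t, B s Q` as a power series in `t`
  set A : (ℕ × ℕ) × (ℕ × ℕ) → ℝ := fun p =>
    (b p.1.1 p.1.2 * P ^ p.1.2) * ((b p.2.1 p.2.2 * Q ^ p.2.2) / ((p.2.1 : ℝ) + 1)) with hA
  have hprod : ∀ t, 0 ≤ t → t ≤ P →
      HasSum (fun p => A p * t ^ (p.1.1 + p.2.1 + 1)) (B t P * ∫ s in (0 : ℝ)..t, B s Q) := by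
    intro t h0 ht
    have h1 := hasSum_B hPP h0 ht
    have h2 := hasSum_integral_B hPQ h0 ht
    have h3 := hasSum_mul_prod h1 h2
    refine hasSum_of_eq h3 fun p => ?_
    simp only [hA]
    ring
  have hsA : Summable fun p => |A p| * P ^ (p.1.1 + p.2.1 + 1) := by
    refine (hprod P hP le_rfl).summable.abs.congr fun p => ?_
    rw [abs_mul, abs_pow, abs_of_nonneg hP]
  have hW := hasSum_integral_monomial hP hsA
  have hW2 : (∫ t in (0 : ℝ)..P, ∑' p, A p * t ^ (p.1.1 + p.2.1 + 1))
      = ∫ t in (0 : ℝ)..P, B t P * ∫ s in (0 : ℝ)..t, B s Q := by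
    refine intervalIntegral.integral_congr fun t ht => ?_
    rw [Set.uIcc_of_le hP] at ht
    exact (hprod t ht.1 ht.2).tsum_eq
  rw [hW2] at hW
  have g1 := hasSum_integral_B hPP hP le_rfl
  have g2 := hasSum_integral_B hPQ hP le_rfl
  have hZ := (hasSum_mul_prod g1 g2).sub hW
  have h4 := hasSum_regroup hZ
  refine hasSum_of_eq h4 fun q => ?_
  rw [x, Finset.sum_mul, Finset.sum_mul]
  refine Finset.sum_congr rfl fun i hi => ?_
  rw [Finset.sum_mul, Finset.sum_mul]
  refine Finset.sum_congr rfl fun j hj => ?_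
  have hi : i < q.1 + 1 := Finset.mem_range.1 hi
  have hj : j < q.1 + 1 - i := Finset.mem_range.1 hj
  have hp : P ^ (q.1 + 2) = P ^ (q.1 - i - j) * P ^ (i + j + 2) := by
    rw [← pow_add]
    congr 1
    omega
  have e1 : P ^ (i + 1) * P ^ (j + 1) = P ^ (i + j + 2) := by
    rw [← pow_add]
    congr 1
    omega
  have n1 : (i : ℝ) + 1 ≠ 0 := by positivity
  have n2 : (j : ℝ) + 1 ≠ 0 := by positivity
  have n3 : (i : ℝ) + j + 2 ≠ 0 := by positivity
  have e2 : ((i : ℝ) + j + 1 + 1) = i + j + 2 := by ring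
  simp only [hA]
  push_cast
  rw [hp, ← e1, e2]
  field_simp
  ring

/-- The recurrence for the numbers `b_{k,ℓ}` says that the random positions of the urns `1/2 + P`
and `1/2 + Q` are in the wrong order with probability `(P + Q) / (1 + P + Q)`: the three terms on
the left are the contributions of the atom, of the positive and of the negative positions of the first
urn. -/
theorem balance_equation {P Q : ℝ} (hP : 0 ≤ P) (hPQ : P < Q) (hQ : P + Q < 1)
    (hsP : Summable (term P P)) (hsQ : Summable (term P Q)) :
    (1 / (1 + P) - ∫ t in (0 : ℝ)..P, B t P) * (Q / (1 + Q) + ∫ t in (0 : ℝ)..P, B t Q)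
      + (∫ t in (0 : ℝ)..P, B t P * (Q / (1 + Q) + ∫ s in (0 : ℝ)..t, B s Q))
      + (∫ t in (0 : ℝ)..P, 1 / (1 + P - t) ^ 2 * ((Q - t) / (1 + Q - t)))
      = (P + Q) / (1 + P + Q) := by
  have hc := hasSum_c hP hPQ hQ
  rw [← hasSum_shift_iff (by intro l; simp [c_zero_left])] at hc
  have hx := hasSum_x hP hsP hsQ
  have hy := hasSum_y hP (by linarith) hsQ
  have hb := (hasSum_integral_B hsQ hP le_rfl).add hc
  have hxy := hx.add (hy.mul_left P)
  -- the recurrence, multiplied by `P ^ (k + 1) * Q ^ l` and summed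
  have key := hb.unique ((hasSum_shift_iff (by intro l; simp [b_zero]; ring)).1
    (hasSum_of_eq hxy fun q => by
      have : (q.1 : ℝ) + 2 ≠ 0 := by positivity
      have e : (q.1 : ℝ) + 1 + 1 = q.1 + 2 := by ring
      simp only [b_succ]
      push_cast
      rw [e]
      field_simp
      ring))
  have hint : (∫ t in (0 : ℝ)..P, B t P * (Q / (1 + Q) + ∫ s in (0 : ℝ)..t, B s Q))
      = (Q / (1 + Q)) * (∫ t in (0 : ℝ)..P, B t P)
        + ∫ t in (0 : ℝ)..P, B t P * ∫ s in (0 : ℝ)..t, B s Q := by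
    have i1 : IntervalIntegrable (fun t => B t P) volume 0 P := by
      apply ContinuousOn.intervalIntegrable
      rw [Set.uIcc_of_le hP]
      exact continuousOn_B hP hsP
    have i2 : IntervalIntegrable (fun t => B t Q) volume 0 P := by
      apply ContinuousOn.intervalIntegrable
      rw [Set.uIcc_of_le hP]
      exact continuousOn_B hP hsQ
    have i3 : IntervalIntegrable (fun t => B t P * ∫ s in (0 : ℝ)..t, B s Q) volume 0 P :=
      i1.mul_continuousOn (intervalIntegral.continuousOn_primitive_interval' i2 Set.left_mem_uIcc)
    rw [← intervalIntegral.integral_const_mul, ← intervalIntegral.integral_add (i1.const_mul _) i3]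
    exact intervalIntegral.integral_congr fun t _ => by ring
  rw [hint]
  have hP1 : 1 + P ≠ 0 := by positivity
  have e1 : ∀ g : ℝ, P * (g / (1 + P)) = g - g / (1 + P) := by
    intro g
    field_simp
    ring
  rw [e1] at key
  linear_combination key

/-! ### The law of the position of an urn -/

/-- The density of the position of the urn `1/2 + Q`, on the interval `(-Q, Q)`. On `(-Q, 0]` it is
forced by the comparison with the urns `p ≤ 1/2`, which lie at `p - 1/2`. -/
noncomputable def density (Q s : ℝ) : ℝ :=
  if s ≤ 0 then 1 / (1 + Q + s) ^ 2 else B s Q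

/-- The weight of the atom of the position of the urn `1/2 + Q`, which lies at `Q`. -/
noncomputable def atom (Q : ℝ) : ℝ :=
  1 / (1 + Q) - ∫ s in (0 : ℝ)..Q, B s Q

/-- The law of the position of the urn `1/2 + Q`. -/
noncomputable def upperLaw (Q : ℝ) : Measure ℝ :=
  ENNReal.ofReal (atom Q) • Measure.dirac Q
    + (volume.restrict (Set.Ioo (-Q) Q)).withDensity fun s => ENNReal.ofReal (density Q s)

theorem intervalIntegral_congr_uIoc {f g : ℝ → ℝ} {u v : ℝ} (h : Set.EqOn f g (Set.uIoc u v)) :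
    ∫ s in u..v, f s = ∫ s in u..v, g s :=
  intervalIntegral.integral_congr_ae (Filter.Eventually.of_forall h)

theorem atom_nonneg (hc : Conjecture) {Q : ℝ} (h0 : 0 ≤ Q) (h1 : Q ≤ 1 / 2) : 0 ≤ atom Q := by
  rw [atom, hc.2.2 Q h0 h1, add_comm 1 Q, sub_sub_cancel]
  exact Real.sqrt_nonneg _

theorem density_nonneg (hc : Conjecture) {Q s : ℝ} (h1 : Q ≤ 1 / 2) (hs : s < Q) :
    0 ≤ density Q s := by
  unfold density
  split_ifs with h
  · positivity
  · exact hc.2.1 s Q (not_le.1 h).le (hs.trans_le h1) hs.le h1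

/-- At `Q = 1/2` the power series need not converge at the end point of the interval; there the
value of the integral, which is not `0`, shows that the function is integrable. -/
theorem intervalIntegrable_B (hc : Conjecture) {Q : ℝ} (h0 : 0 ≤ Q) (h1 : Q ≤ 1 / 2) :
    IntervalIntegrable (fun s => B s Q) volume 0 Q := by
  rcases h1.lt_or_eq with h | rfl
  · apply ContinuousOn.intervalIntegrable
    rw [Set.uIcc_of_le h0]
    exact continuousOn_B h0 (hc.1 Q Q h0 h le_rfl h1)
  · by_contra h
    have h2 := hc.2.2 (1 / 2) h0 le_rfl
    rw [intervalIntegral.integral_undef h] at h2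
    norm_num at h2

theorem intervalIntegrable_sq_inv {Q t : ℝ} (ht : -Q ≤ t) :
    IntervalIntegrable (fun s => 1 / (1 + Q + s) ^ 2) volume (-Q) t := by
  apply ContinuousOn.intervalIntegrable
  rw [Set.uIcc_of_le ht]
  refine ContinuousOn.div (by fun_prop) (by fun_prop) fun s hs => ?_
  have : 0 < 1 + Q + s := by linarith [hs.1]
  positivity

theorem density_eqOn_of_nonpos {Q u v : ℝ} (hu : u ≤ 0) (hv : v ≤ 0) :
    Set.EqOn (fun s => 1 / (1 + Q + s) ^ 2) (density Q) (Set.uIoc u v) := by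
  intro s hs
  have : s ≤ 0 := by
    rcases Set.mem_uIoc.1 hs with h | h
    exacts [h.2.trans hv, h.2.trans hu]
  simp [density, this]

theorem density_eqOn_of_nonneg {Q t : ℝ} (ht : 0 ≤ t) :
    Set.EqOn (fun s => B s Q) (density Q) (Set.uIoc 0 t) := by
  intro s hs
  rw [Set.uIoc_of_le ht] at hs
  simp [density, not_le.2 hs.1]

theorem intervalIntegrable_density_left {Q t : ℝ} (ht : -Q ≤ t) (ht0 : t ≤ 0) :
    IntervalIntegrable (density Q) volume (-Q) t :=
  (intervalIntegrable_congr (density_eqOn_of_nonpos (ht.trans ht0) ht0)).1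
    (intervalIntegrable_sq_inv ht)

theorem intervalIntegrable_density (hc : Conjecture) {Q : ℝ} (h0 : 0 ≤ Q) (h1 : Q ≤ 1 / 2) :
    IntervalIntegrable (density Q) volume (-Q) Q :=
  (intervalIntegrable_density_left (by linarith) le_rfl).trans
    ((intervalIntegrable_congr (density_eqOn_of_nonneg h0)).1 (intervalIntegrable_B hc h0 h1))

theorem integral_density_of_nonpos {Q t : ℝ} (ht : -Q ≤ t) (ht0 : t ≤ 0) :
    ∫ s in (-Q)..t, density Q s = (Q + t) / (1 + Q + t) := by
  have hpos : ∀ s ∈ Set.uIcc (-Q) t, 0 < 1 + Q + s := by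
    intro s hs
    rw [Set.uIcc_of_le ht] at hs
    linarith [hs.1]
  have hd : ∀ s ∈ Set.uIcc (-Q) t,
      HasDerivAt (fun s => -(1 + Q + s)⁻¹) (1 / (1 + Q + s) ^ 2) s := by
    intro s hs
    have l : HasDerivAt (fun s => 1 + Q + s) 1 s := by
      simpa using (hasDerivAt_id s).const_add (1 + Q)
    exact (l.fun_inv (hpos s hs).ne').neg.congr_deriv (by ring)
  rw [← intervalIntegral_congr_uIoc (density_eqOn_of_nonpos (ht.trans ht0) ht0),
    intervalIntegral.integral_eq_sub_of_hasDerivAt hd (intervalIntegrable_sq_inv ht)]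
  have := (hpos t Set.right_mem_uIcc).ne'
  field_simp
  ring

theorem integral_density_of_nonneg (hc : Conjecture) {Q t : ℝ} (h0 : 0 ≤ Q) (h1 : Q ≤ 1 / 2)
    (ht0 : 0 ≤ t) (ht : t ≤ Q) :
    ∫ s in (-Q)..t, density Q s = Q / (1 + Q) + ∫ s in (0 : ℝ)..t, B s Q := by
  have i0 : IntervalIntegrable (density Q) volume (-Q) 0 :=
    intervalIntegrable_density_left (by linarith) le_rfl
  have i1 : IntervalIntegrable (density Q) volume 0 t :=
    (intervalIntegrable_density hc h0 h1).mono_set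
      (by rw [Set.uIcc_of_le ht0, Set.uIcc_of_le (by linarith)]
          exact Set.Icc_subset_Icc (by linarith) ht)
  rw [← intervalIntegral.integral_add_adjacent_intervals i0 i1,
    integral_density_of_nonpos (by linarith) le_rfl,
    intervalIntegral_congr_uIoc (density_eqOn_of_nonneg ht0)]
  simp

theorem setLIntegral_Ioo_ofReal {f : ℝ → ℝ} {u v : ℝ} (huv : u ≤ v)
    (hf : IntervalIntegrable f volume u v) (h0 : ∀ s ∈ Set.Ioo u v, 0 ≤ f s) :
    ∫⁻ s in Set.Ioo u v, ENNReal.ofReal (f s) = ENNReal.ofReal (∫ s in u..v, f s) := by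
  rw [intervalIntegral.integral_of_le huv, integral_Ioc_eq_integral_Ioo,
    ofReal_integral_eq_lintegral_ofReal]
  · exact ((intervalIntegrable_iff_integrableOn_Ioo_of_le huv).1 hf)
  · exact (ae_restrict_iff' measurableSet_Ioo).2 (Filter.Eventually.of_forall h0)

theorem upperLaw_Iio (hc : Conjecture) {Q t : ℝ} (h0 : 0 ≤ Q) (h1 : Q ≤ 1 / 2)
    (ht : -Q ≤ t) (htQ : t ≤ Q) :
    upperLaw Q (Set.Iio t) = ENNReal.ofReal (∫ s in (-Q)..t, density Q s) := by
  have hi : IntervalIntegrable (density Q) volume (-Q) t :=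
    (intervalIntegrable_density hc h0 h1).mono_set
      (by rw [Set.uIcc_of_le ht, Set.uIcc_of_le (by linarith)]
          exact Set.Icc_subset_Icc le_rfl htQ)
  rw [upperLaw, Measure.add_apply, Measure.smul_apply, Measure.dirac_apply' _ measurableSet_Iio,
    Set.indicator_of_notMem (by simpa using htQ), withDensity_apply _ measurableSet_Iio,
    Measure.restrict_restrict measurableSet_Iio, smul_zero, zero_add]
  have hset : Set.Iio t ∩ Set.Ioo (-Q) Q = Set.Ioo (-Q) t := by
    ext s
    simp only [Set.mem_inter_iff, Set.mem_Iio, Set.mem_Ioo]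
    constructor
    · exact fun h => ⟨h.2.1, h.1⟩
    · exact fun h => ⟨h.2, h.1, h.2.trans_le htQ⟩
  rw [hset, setLIntegral_Ioo_ofReal ht hi]
  exact fun s hs => density_nonneg hc h1 (hs.2.trans_le htQ)

theorem upperLaw_Iio_of_le {Q t : ℝ} (h0 : 0 ≤ Q) (ht : t ≤ -Q) :
    upperLaw Q (Set.Iio t) = 0 := by
  rw [upperLaw, Measure.add_apply, Measure.smul_apply, Measure.dirac_apply' _ measurableSet_Iio,
    Set.indicator_of_notMem (by simp; linarith), withDensity_apply _ measurableSet_Iio,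
    Measure.restrict_restrict measurableSet_Iio, smul_zero, zero_add]
  have hset : Set.Iio t ∩ Set.Ioo (-Q) Q = ∅ := by
    ext s
    simp only [Set.mem_inter_iff, Set.mem_Iio, Set.mem_Ioo, Set.mem_empty_iff_false, iff_false]
    intro h
    linarith [h.1, h.2.1]
  simp [hset]

theorem isProbabilityMeasure_upperLaw (hc : Conjecture) {Q : ℝ} (h0 : 0 ≤ Q) (h1 : Q ≤ 1 / 2) :
    IsProbabilityMeasure (upperLaw Q) := by
  constructor
  have hd : ∀ s ∈ Set.Ioo (-Q) Q, 0 ≤ density Q s := fun s hs => density_nonneg hc h1 hs.2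
  rw [upperLaw, Measure.add_apply, Measure.smul_apply, withDensity_apply _ MeasurableSet.univ,
    Measure.restrict_univ, measure_univ, smul_eq_mul, mul_one,
    setLIntegral_Ioo_ofReal (by linarith) (intervalIntegrable_density hc h0 h1) hd,
    ← ENNReal.ofReal_add (atom_nonneg hc h0 h1), integral_density_of_nonneg hc h0 h1 h0 le_rfl,
    ← ENNReal.ofReal_one]
  · congr 1
    have : 1 + Q ≠ 0 := by positivity
    rw [atom]
    field_simp
    ring
  · refine intervalIntegral.integral_nonneg_of_ae_restrict (by linarith) ?_
    rw [Measure.restrict_congr_set Ioo_ae_eq_Icc.symm]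
    exact (ae_restrict_iff' measurableSet_Ioo).2 (Filter.Eventually.of_forall hd)

/-- The positions of two urns with more blue balls than red ones are in the wrong order with this
probability, by `balance_equation`. -/
theorem lintegral_upperLaw_Iio (hc : Conjecture) {P Q : ℝ} (hP : 0 ≤ P) (hPQ : P < Q)
    (hQ : Q ≤ 1 / 2) :
    ∫⁻ s, upperLaw Q (Set.Iio s) ∂(upperLaw P) = ENNReal.ofReal ((P + Q) / (1 + P + Q)) := by
  have hP1 : P < 1 / 2 := hPQ.trans_le hQ
  have hQ0 : 0 ≤ Q := hP.trans hPQ.le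
  have hmeas : Measurable fun s => upperLaw Q (Set.Iio s) :=
    Monotone.measurable fun s t hst => measure_mono (Set.Iio_subset_Iio hst)
  have hdQ := intervalIntegrable_density hc hQ0 hQ
  have hdP := intervalIntegrable_density hc hP hP1.le
  have hcont : ContinuousOn (fun t => ∫ s in (-Q)..t, density Q s) (Set.uIcc (-Q) Q) :=
    intervalIntegral.continuousOn_primitive_interval' hdQ Set.left_mem_uIcc
  have hnn : ∀ t, -Q ≤ t → t ≤ Q → 0 ≤ ∫ s in (-Q)..t, density Q s := by
    intro t h1 h2
    refine intervalIntegral.integral_nonneg_of_ae_restrict h1 ?_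
    rw [Measure.restrict_congr_set Ioo_ae_eq_Icc.symm]
    exact (ae_restrict_iff' measurableSet_Ioo).2 (Filter.Eventually.of_forall
      fun s hs => density_nonneg hc hQ (hs.2.trans_le h2))
  have hi : IntervalIntegrable (fun t => density P t * ∫ s in (-Q)..t, density Q s)
      volume (-P) P := by
    refine hdP.mul_continuousOn (hcont.mono ?_)
    rw [Set.uIcc_of_le (by linarith), Set.uIcc_of_le (by linarith)]
    exact Set.Icc_subset_Icc (by linarith) hPQ.le
  have hmd : AEMeasurable (fun s => ENNReal.ofReal (density P s))
      (volume.restrict (Set.Ioo (-P) P)) :=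
    ((intervalIntegrable_iff_integrableOn_Ioo_of_le (by linarith)).1 hdP).aemeasurable.ennreal_ofReal
  have hcontPart : ∫⁻ s, upperLaw Q (Set.Iio s) ∂((volume.restrict (Set.Ioo (-P) P)).withDensity
      fun s => ENNReal.ofReal (density P s))
      = ENNReal.ofReal (∫ t in (-P)..P, density P t * ∫ s in (-Q)..t, density Q s) := by
    rw [lintegral_withDensity_eq_lintegral_mul₀ hmd hmeas.aemeasurable,
      ← setLIntegral_Ioo_ofReal (by linarith) hi]
    · refine setLIntegral_congr_fun measurableSet_Ioo fun s hs => ?_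
      rw [Pi.mul_apply, upperLaw_Iio hc hQ0 hQ (by linarith [hs.1]) (by linarith [hs.2]),
        ENNReal.ofReal_mul (density_nonneg hc hP1.le hs.2)]
    · exact fun s hs => mul_nonneg (density_nonneg hc hP1.le hs.2)
        (hnn s (by linarith [hs.1]) (by linarith [hs.2]))
  have hnonneg : 0 ≤ ∫ t in (-P)..P, density P t * ∫ s in (-Q)..t, density Q s := by
    refine intervalIntegral.integral_nonneg_of_ae_restrict (by linarith) ?_
    rw [Measure.restrict_congr_set Ioo_ae_eq_Icc.symm]
    exact (ae_restrict_iff' measurableSet_Ioo).2 (Filter.Eventually.of_forall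
      fun s hs => mul_nonneg (density_nonneg hc hP1.le hs.2)
        (hnn s (by linarith [hs.1]) (by linarith [hs.2])))
  rw [show upperLaw P = ENNReal.ofReal (atom P) • Measure.dirac P
    + (volume.restrict (Set.Ioo (-P) P)).withDensity fun s => ENNReal.ofReal (density P s) from rfl,
    lintegral_add_measure, lintegral_smul_measure, lintegral_dirac' _ hmeas, hcontPart,
    upperLaw_Iio hc hQ0 hQ (by linarith) hPQ.le, smul_eq_mul,
    ← ENNReal.ofReal_mul (atom_nonneg hc hP hP1.le),
    ← ENNReal.ofReal_add (mul_nonneg (atom_nonneg hc hP hP1.le) (hnn P (by linarith) hPQ.le))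
      hnonneg,
    ← balance_equation hP hPQ (by linarith) (hc.1 P P hP hP1 le_rfl hP1.le)
      (hc.1 P Q hP hP1 hPQ.le hQ)]
  congr 1
  have il : IntervalIntegrable (fun t => density P t * ∫ s in (-Q)..t, density Q s)
      volume (-P) 0 := hi.mono_set (by
        rw [Set.uIcc_of_le (by linarith), Set.uIcc_of_le (by linarith)]
        exact Set.Icc_subset_Icc le_rfl hP)
  have ir : IntervalIntegrable (fun t => density P t * ∫ s in (-Q)..t, density Q s)
      volume 0 P := hi.mono_set (by
        rw [Set.uIcc_of_le hP, Set.uIcc_of_le (by linarith)]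
        exact Set.Icc_subset_Icc (by linarith) le_rfl)
  have el : ∫ t in (-P)..0, density P t * ∫ s in (-Q)..t, density Q s
      = ∫ t in (0 : ℝ)..P, 1 / (1 + P - t) ^ 2 * ((Q - t) / (1 + Q - t)) := by
    rw [← neg_zero, ← intervalIntegral.integral_comp_neg, neg_zero]
    refine intervalIntegral.integral_congr fun t ht => ?_
    rw [Set.uIcc_of_le hP] at ht
    have h2 := ht.1
    have h3 := ht.2
    rw [integral_density_of_nonpos (by linarith) (by linarith), density, if_pos (by linarith)]
    simp only [← sub_eq_add_neg]
  have er : ∫ t in (0 : ℝ)..P, density P t * ∫ s in (-Q)..t, density Q s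
      = ∫ t in (0 : ℝ)..P, B t P * (Q / (1 + Q) + ∫ s in (0 : ℝ)..t, B s Q) := by
    refine intervalIntegral_congr_uIoc fun t ht => ?_
    have h2 := density_eqOn_of_nonneg (Q := P) hP ht
    rw [Set.uIoc_of_le hP] at ht
    simp only at h2 ⊢
    rw [← h2, integral_density_of_nonneg hc hQ0 hQ ht.1.le (ht.2.trans hPQ.le)]
  rw [← intervalIntegral.integral_add_adjacent_intervals il ir, el, er,
    integral_density_of_nonneg hc hQ0 hQ hP hPQ.le, atom]
  ring

/-- The law of the position of the urn with a fraction `p` of blue balls: for `p ≤ 1/2` the position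
is `p - 1/2`, and for `p > 1/2` it is random. -/
noncomputable def positionLaw (p : ℝ) : Measure ℝ :=
  if p ≤ 1 / 2 then Measure.dirac (p - 1 / 2) else upperLaw (p - 1 / 2)

theorem isProbabilityMeasure_positionLaw (hc : Conjecture) {p : ℝ} (h1 : p ≤ 1) :
    IsProbabilityMeasure (positionLaw p) := by
  unfold positionLaw
  split_ifs with h
  · infer_instance
  · exact isProbabilityMeasure_upperLaw hc (by linarith) (by linarith)

/-- The urns `p < q` are in the wrong order with probability `1 - min (1, 1 / (p + q))`. -/
theorem lintegral_positionLaw_Iio (hc : Conjecture) {p q : ℝ} (hp : 0 ≤ p) (hpq : p < q)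
    (hq : q ≤ 1) :
    ∫⁻ s, positionLaw q (Set.Iio s) ∂(positionLaw p)
      = ENNReal.ofReal (1 - min 1 (1 / (p + q))) := by
  have hpos : 0 < p + q := by linarith
  unfold positionLaw
  by_cases hq2 : q ≤ 1 / 2
  · have hmin : min 1 (1 / (p + q)) = 1 :=
      min_eq_left ((one_le_div hpos).2 (by linarith))
    rw [if_pos hq2, if_pos (hpq.le.trans hq2), hmin, lintegral_dirac,
      Measure.dirac_apply' _ measurableSet_Iio, Set.indicator_of_notMem (by simp; linarith)]
    simp
  by_cases hp2 : p ≤ 1 / 2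
  · rw [if_neg hq2, if_pos hp2, lintegral_dirac]
    rcases le_total (p + q) 1 with h | h
    · rw [min_eq_left ((one_le_div hpos).2 h), upperLaw_Iio_of_le (by linarith) (by linarith)]
      simp
    · rw [min_eq_right ((div_le_one hpos).2 h),
        upperLaw_Iio hc (by linarith) (by linarith) (by linarith) (by linarith),
        integral_density_of_nonpos (by linarith) (by linarith)]
      congr 1
      rw [show 1 + (q - 1 / 2) + (p - 1 / 2) = p + q by ring]
      field_simp
      ring
  · rw [if_neg hq2, if_neg hp2,
      lintegral_upperLaw_Iio hc (by linarith) (by linarith) (by linarith),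
      min_eq_right ((div_le_one hpos).2 (by linarith))]
    congr 1
    rw [show 1 + (p - 1 / 2) + (q - 1 / 2) = p + q by ring]
    field_simp
    ring

/-! ### Sorting random positions -/

/-- The ranks of the entries of `X`, with ties broken by the index. -/
noncomputable def rankPerm {n : ℕ} (X : Fin n → ℝ) : Equiv.Perm (Fin n) :=
  (Tuple.sort X)⁻¹

theorem rankPerm_lt_iff {n : ℕ} (X : Fin n → ℝ) {i j : Fin n} (hij : i < j) :
    rankPerm X i < rankPerm X j ↔ X i ≤ X j := by
  obtain ⟨hm, ht⟩ := (Tuple.eq_sort_iff (f := X)).1 (rfl : Tuple.sort X = Tuple.sort X)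
  have hs : ∀ i, Tuple.sort X (rankPerm X i) = i := fun i => Equiv.apply_symm_apply _ _
  constructor
  · intro h
    have := hm h.le
    simpa [hs] using this
  · intro h
    by_contra hlt
    have hne : rankPerm X j ≠ rankPerm X i := fun he => hij.ne' ((rankPerm X).injective he)
    have hlt : rankPerm X j < rankPerm X i := lt_of_le_of_ne (not_lt.1 hlt) hne
    have h1 := hm hlt.le
    have h2 := ht _ _ hlt
    simp only [Function.comp_apply, hs] at h1 h2
    exact lt_asymm hij (h2 (le_antisymm h1 h))

theorem measurable_rankPerm {n : ℕ} :
    Measurable (rankPerm : (Fin n → ℝ) → Equiv.Perm (Fin n)) := by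
  refine measurable_to_countable' fun π => ?_
  have : (rankPerm : (Fin n → ℝ) → Equiv.Perm (Fin n)) ⁻¹' {π}
      = ⋂ (i : Fin n) (j : Fin n) (_ : i < j), {X | X (π⁻¹ i) ≤ X (π⁻¹ j)} ∩
          {X | X (π⁻¹ i) = X (π⁻¹ j) → π⁻¹ i < π⁻¹ j} := by
    ext X
    simp only [Set.mem_preimage, Set.mem_singleton_iff, rankPerm, Set.mem_iInter, Set.mem_inter_iff,
      Set.mem_ofPred_eq]
    rw [inv_eq_iff_eq_inv, eq_comm, Tuple.eq_sort_iff]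
    constructor
    · exact fun h i j hij => ⟨h.1 hij.le, h.2 i j hij⟩
    · refine fun h => ⟨fun i j hij => ?_, fun i j hij => (h i j hij).2⟩
      rcases hij.lt_or_eq with hlt | rfl
      exacts [(h i j hlt).1, le_rfl]
  rw [this]
  refine MeasurableSet.iInter fun i => MeasurableSet.iInter fun j => MeasurableSet.iInter fun _ => ?_
  refine (measurableSet_le (by fun_prop) (by fun_prop)).inter ?_
  by_cases h : π⁻¹ i < π⁻¹ j
  · simp only [h, implies_true]
    exact MeasurableSet.const True
  · simp only [h, imp_false]
    exact (measurableSet_eq_fun (by fun_prop) (by fun_prop)).compl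

theorem pi_lt_eq_lintegral {n : ℕ} (ν : Fin n → Measure ℝ) [∀ i, IsProbabilityMeasure (ν i)]
    {i j : Fin n} (hij : i ≠ j) :
    Measure.pi ν {X | X j < X i} = ∫⁻ s, ν j (Set.Iio s) ∂(ν i) := by
  have hind : iIndepFun (fun k (X : Fin n → ℝ) => X k) (Measure.pi ν) :=
    iIndepFun_pi (X := fun _ => id) fun _ => aemeasurable_id
  have h2 := (indepFun_iff_map_prod_eq_prod_map_map
    (measurable_pi_apply i).aemeasurable (measurable_pi_apply j).aemeasurable).1
    (hind.indepFun hij)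
  have hm : MeasurableSet {z : ℝ × ℝ | z.2 < z.1} := measurableSet_lt measurable_snd measurable_fst
  have h3 : Measure.pi ν {X | X j < X i}
      = (Measure.pi ν).map (fun X => (X i, X j)) {z : ℝ × ℝ | z.2 < z.1} := by
    rw [Measure.map_apply (by fun_prop) hm]
    rfl
  have he : ∀ k, (Measure.pi ν).map (fun X => X k) = ν k := fun k =>
    (measurePreserving_eval ν k).map_eq
  rw [h3, h2, he, he, Measure.prod_apply hm]
  rfl

/-- The distribution over the permutations that ranks the urns by independent random positions. -/
theorem exists_pmf_lt_eq (hc : Conjecture) {n : ℕ} (p : Fin n → unitInterval)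
    (hp : StrictMono p) :
    ∃ μ : PMF (Equiv.Perm (Fin n)), ∀ i j : Fin n, i < j →
      (μ.toMeasure {π | π i < π j}).toReal = min 1 (1 / ((p i : ℝ) + (p j : ℝ))) := by
  have (i : Fin n) : IsProbabilityMeasure (positionLaw (p i)) :=
    isProbabilityMeasure_positionLaw hc (p i).2.2
  set ν : Measure (Fin n → ℝ) := Measure.pi fun i => positionLaw (p i) with hν
  have : IsProbabilityMeasure (ν.map rankPerm) :=
    Measure.isProbabilityMeasure_map measurable_rankPerm.aemeasurable
  refine ⟨(ν.map rankPerm).toPMF, fun i j hij => ?_⟩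
  rw [Measure.toPMF_toMeasure, Measure.map_apply measurable_rankPerm MeasurableSet.of_discrete]
  have hset : rankPerm ⁻¹' {π : Equiv.Perm (Fin n) | π i < π j}
      = {X : Fin n → ℝ | X j < X i}ᶜ := by
    ext X
    simp [rankPerm_lt_iff X hij]
  have hpos : (0 : ℝ) < p i + p j := add_pos_of_nonneg_of_pos (p i).2.1
    ((p i).2.1.trans_lt (hp hij))
  rw [hset, prob_compl_eq_one_sub (measurableSet_lt (by fun_prop) (by fun_prop)), hν,
    pi_lt_eq_lintegral _ hij.ne, lintegral_positionLaw_Iio hc (p i).2.1 (hp hij) (p j).2.2,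
    ← ENNReal.ofReal_one, ← ENNReal.ofReal_sub _ (by simp), sub_sub_cancel,
    ENNReal.toReal_ofReal (by positivity)]

/-! ### The voting scheme -/

/-- The two colors, indexed by the truth value of being blue. -/
def colorEquiv : Bool ≃ Color :=
  ⟨fun t => if t then Color.blue else Color.red,
    fun col => match col with | Color.blue => true | Color.red => false,
    fun t => by cases t <;> rfl, fun col => by cases col <;> rfl⟩

theorem ballotLaw_real {n : ℕ} (σ : SymmetricScheme n) (q : unitInterval) (S : Set (Ballot n)) :
    (ballotLaw σ q).toMeasure.real S
      = q * (σ Color.blue).toMeasure.real S + (1 - q) * (σ Color.red).toMeasure.real S := by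
  have hb : drawBall q Color.blue = ENNReal.ofReal (q : ℝ) := rfl
  have hr : drawBall q Color.red = ENNReal.ofReal (1 - (q : ℝ)) := rfl
  rw [measureReal_def, ballotLaw, PMF.toMeasure_bind_apply _ _ _ MeasurableSet.of_discrete,
    ← colorEquiv.tsum_eq, tsum_bool]
  simp only [colorEquiv, Equiv.coe_fn_mk, if_true, Bool.false_eq_true, if_false, hb, hr]
  rw [ENNReal.toReal_add (ENNReal.mul_ne_top ENNReal.ofReal_ne_top (measure_ne_top _ _))
    (ENNReal.mul_ne_top ENNReal.ofReal_ne_top (measure_ne_top _ _)), ENNReal.toReal_mul,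
    ENNReal.toReal_mul, ENNReal.toReal_ofReal q.2.1, ENNReal.toReal_ofReal (sub_nonneg.2 q.2.2),
    add_comm]
  rfl

theorem real_lt_swap {n : ℕ} (μ : PMF (Ballot n)) {i j : Fin n} (hij : i ≠ j) :
    μ.toMeasure.real {π | π j < π i} = 1 - μ.toMeasure.real {π | π i < π j} := by
  have h : {π : Ballot n | π j < π i} = {π : Ballot n | π i < π j}ᶜ := by
    ext π
    have hne : π i ≠ π j := fun h => hij (π.injective h)
    simp only [Set.mem_ofPred_eq, Set.mem_compl_iff, not_lt]
    exact ⟨le_of_lt, fun h => lt_of_le_of_ne h hne.symm⟩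
  rw [h, probReal_compl_eq_one_sub MeasurableSet.of_discrete]

/-- Reversing the urns and exchanging the colors gives the rule for a red ball. -/
theorem exists_pmf_red (hc : Conjecture) {n : ℕ} (p : Fin n → unitInterval) (hp : StrictMono p) :
    ∃ μ : PMF (Ballot n), ∀ i j : Fin n, i < j →
      μ.toMeasure.real {π | π j < π i} = min 1 (1 / (2 - ((p i : ℝ) + (p j : ℝ)))) := by
  obtain ⟨μ, hμ⟩ := exists_pmf_lt_eq hc (fun i => unitInterval.symm (p (Fin.rev i))) (by
    intro i j hij
    have := hp (Fin.rev_lt_rev.2 hij)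
    rw [← Subtype.coe_lt_coe] at this ⊢
    simp only [unitInterval.coe_symm_eq]
    linarith)
  refine ⟨μ.map fun π => Fin.revPerm.trans π, fun i j hij => ?_⟩
  have h := hμ _ _ (Fin.rev_lt_rev.2 hij)
  simp only [Fin.rev_rev, unitInterval.coe_symm_eq] at h
  rw [measureReal_def, PMF.toMeasure_map_apply _ _ _ (Measurable.of_discrete)
    MeasurableSet.of_discrete]
  rw [show (2 : ℝ) - ((p i : ℝ) + (p j : ℝ)) = 1 - p j + (1 - p i) by ring, ← h]
  rfl

/-- For `s` the sum of the fractions of blue balls in two urns, the two rules balance exactly at the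
midpoint `q = s / 2`; from there the majority for the urn with more blue balls grows linearly. -/
theorem half_add_le_mix {q s : ℝ} (hs0 : 0 < s) (hs2 : s < 2) (hq : s / 2 ≤ q) :
    1 / 2 + (q - s / 2) / 2 ≤ q * min 1 (1 / s) + (1 - q) * (1 - min 1 (1 / (2 - s))) := by
  have h2 : 0 < 2 - s := by linarith
  have hd : 0 ≤ q - s / 2 := by linarith
  rcases le_total s 1 with h | h
  · rw [min_eq_left ((one_le_div hs0).2 h), min_eq_right ((div_le_one h2).2 (by linarith))]
    have e : q * 1 + (1 - q) * (1 - 1 / (2 - s)) = 1 / 2 + (q - s / 2) / (2 - s) := by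
      field_simp
      ring
    rw [e]
    gcongr
    linarith
  · rw [min_eq_right ((div_le_one hs0).2 h), min_eq_left ((one_le_div h2).2 (by linarith))]
    have e : q * (1 / s) + (1 - q) * (1 - 1) = 1 / 2 + (q - s / 2) / s := by
      field_simp
      ring
    rw [e]
    gcongr

theorem exists_scheme (hc : Conjecture) {n : ℕ} (p : Fin n → unitInterval) (hp : StrictMono p) :
    ∃ σ : SymmetricScheme n, ∀ u j : Fin n, j ≠ u →
      1 / 2 + |(p u : ℝ) - p j| / 4
        ≤ (ballotLaw σ (p u)).toMeasure.real {π | π j < π u} := by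
  obtain ⟨μ, hμ⟩ := exists_pmf_lt_eq hc p hp
  obtain ⟨ν, hν⟩ := exists_pmf_red hc p hp
  refine ⟨fun col => match col with | Color.blue => μ | Color.red => ν, fun u j hju => ?_⟩
  rw [ballotLaw_real]
  simp only
  rcases lt_or_gt_of_ne hju with h | h
  · have hlt : (p j : ℝ) < p u := hp h
    have h0 := (p j).2.1
    have h1 := (p u).2.2
    rw [real_lt_swap ν h.ne', hν j u h, measureReal_def, hμ j u h, abs_of_pos (by linarith)]
    have := half_add_le_mix (q := p u) (s := p j + p u) (by linarith) (by linarith) (by linarith)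
    linarith
  · have hlt : (p u : ℝ) < p j := hp h
    have h0 := (p u).2.1
    have h1 := (p j).2.2
    rw [hν u j h, real_lt_swap μ h.ne, measureReal_def, hμ u j h, abs_of_neg (by linarith)]
    have := half_add_le_mix (q := 1 - p u) (s := 2 - (p u + p j)) (by linarith) (by linarith)
      (by linarith)
    rw [sub_sub_cancel, sub_sub_cancel] at this
    linarith

/-! ### The number of voters -/

/-- Hoeffding's inequality for the majority of independent voters. -/
theorem measureReal_pi_card_le {Ω : Type*} [MeasurableSpace Ω] (μ : Measure Ω)
    [IsProbabilityMeasure μ] {S : Set Ω} [DecidablePred (· ∈ S)] (hS : MeasurableSet S) (m : ℕ)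
    {δ : ℝ} (hδ : 0 ≤ δ) (h : 1 / 2 + δ ≤ μ.real S) :
    (Measure.pi fun _ : Fin m => μ).real
      {v | ((Finset.univ.filter fun t : Fin m => v t ∈ S).card : ℝ) ≤ (m : ℝ) / 2}
      ≤ Real.exp (-(2 * m * δ ^ 2)) := by
  set X : Ω → ℝ := fun ω => -S.indicator 1 ω with hX
  have hXm : Measurable X := (measurable_one.indicator hS).neg
  have hmean : ∫ ω, X ω ∂μ = -μ.real S := by
    rw [hX, integral_neg, integral_indicator_one hS]
  have hsub : HasSubgaussianMGF (fun ω => X ω - ∫ ω, X ω ∂μ) ((‖(0 : ℝ) - -1‖₊ / 2) ^ 2) μ :=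
    hasSubgaussianMGF_of_mem_Icc hXm.aemeasurable (Filter.Eventually.of_forall fun ω => by
      by_cases hω : ω ∈ S <;> simp [hX, hω])
  have hind : iIndepFun (fun (t : Fin m) (v : Fin m → Ω) => X (v t) - ∫ ω, X ω ∂μ)
      (Measure.pi fun _ : Fin m => μ) :=
    iIndepFun_pi (X := fun _ ω => X ω - ∫ ω, X ω ∂μ) fun _ => (hXm.sub_const _).aemeasurable
  have hoeff := HasSubgaussianMGF.measure_sum_ge_le_of_iIndepFun hind (s := Finset.univ)
    (c := fun _ => (‖(0 : ℝ) - -1‖₊ / 2) ^ 2) (ε := m * δ) (fun t _ => by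
      refine HasSubgaussianMGF.of_map (Y := fun v : Fin m → Ω => v t)
        (X := fun ω => X ω - ∫ ω, X ω ∂μ) (measurable_pi_apply t).aemeasurable ?_
      rw [(measurePreserving_eval (fun _ : Fin m => μ) t).map_eq]
      exact hsub) (by positivity)
  refine (measureReal_mono ?_).trans (hoeff.trans_eq ?_)
  · intro v hv
    simp only [Set.mem_ofPred_eq] at hv ⊢
    have hsum : ∑ t : Fin m, (X (v t) - ∫ ω, X ω ∂μ)
        = m * μ.real S - ((Finset.univ.filter fun t : Fin m => v t ∈ S).card : ℝ) := by
      rw [hmean, Finset.sum_sub_distrib]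
      simp [hX, Set.indicator_apply]
      ring
    rw [hsum]
    have : (m : ℝ) * (1 / 2 + δ) ≤ m * μ.real S := by gcongr
    linarith
  · congr 1
    rcases Nat.eq_zero_or_pos m with rfl | hm
    · simp
    · have : (m : ℝ) ≠ 0 := by positivity
      simp
      field_simp

theorem mul_gap_le {n : ℕ} {p : Fin n → unitInterval} {ε : ℝ} (hε : IsMinGap p ε) (i j : Fin n)
    (hij : i ≤ j) : ((j.val - i.val : ℕ) : ℝ) * ε ≤ (p j : ℝ) - p i := by
  obtain ⟨d, hd⟩ := Nat.exists_eq_add_of_le (Fin.le_def.1 hij)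
  induction d generalizing j with
  | zero =>
    have : i = j := Fin.ext (by omega)
    simp [this]
  | succ d ih =>
    have hk : i.val + d < n := by omega
    have h1 := ih ⟨i.val + d, hk⟩ (Fin.le_def.2 (by simp)) rfl
    have h2 := hε.2 ⟨⟨i.val + d, hk⟩, j, by simp; omega, rfl⟩
    have e : ((j.val - i.val : ℕ) : ℝ) = ((i.val + d - i.val : ℕ) : ℝ) + 1 := by
      rw [hd]
      have : i.val + (d + 1) - i.val = (i.val + d - i.val) + 1 := by omega
      rw [this]
      push_cast
      ring
    rw [e]
    simp only at h1
    linarith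

theorem sum_pow_le_geometric {ι : Type*} (s : Finset ι) (f : ι → ℕ) (hf : Set.InjOn f s)
    (hpos : ∀ a ∈ s, 1 ≤ f a) {r : ℝ} (h0 : 0 ≤ r) (h1 : r < 1) :
    ∑ a ∈ s, r ^ f a ≤ r / (1 - r) := by
  classical
  have hinj : Set.InjOn (fun a => f a - 1) s := by
    intro a ha a' ha' h
    have := hpos a ha
    have := hpos a' ha'
    simp only at h
    exact hf ha ha' (by omega)
  have e : ∑ a ∈ s, r ^ f a = r * ∑ d ∈ s.image fun a => f a - 1, r ^ d := by
    rw [Finset.sum_image hinj, Finset.mul_sum]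
    refine Finset.sum_congr rfl fun a ha => ?_
    rw [← pow_succ', Nat.sub_add_cancel (hpos a ha)]
  rw [e, div_eq_mul_inv, ← tsum_geometric_of_lt_one h0 h1]
  gcongr
  exact (summable_geometric_of_lt_one h0 h1).sum_le_tsum _ fun d _ => by positivity

/-- The distance of the indices of two urns; one of the two truncated differences is `0`. -/
def indexDist {n : ℕ} (i j : Fin n) : ℕ := (j.val - i.val) + (i.val - j.val)

theorem sum_pow_indexDist_le {n : ℕ} (u : Fin n) {r : ℝ} (h0 : 0 ≤ r) (h1 : r < 1) :
    ∑ j ∈ Finset.univ.erase u, r ^ indexDist u j ≤ 2 * (r / (1 - r)) := by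
  rw [← Finset.sum_filter_add_sum_filter_not (Finset.univ.erase u) (fun j => j < u), two_mul]
  refine add_le_add (sum_pow_le_geometric _ _ ?_ ?_ h0 h1) (sum_pow_le_geometric _ _ ?_ ?_ h0 h1)
  all_goals
    simp only [indexDist, Set.InjOn, Finset.coe_filter, Finset.mem_erase, Finset.mem_univ, and_true,
      Set.mem_ofPred_eq, Finset.mem_filter, Fin.lt_def, Fin.ext_iff, ne_eq, not_lt]
    intros
    omega

theorem indexDist_mul_le {n : ℕ} {p : Fin n → unitInterval} {ε : ℝ} (hε : IsMinGap p ε)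
    (i j : Fin n) : (indexDist i j : ℝ) * ε ≤ |(p i : ℝ) - p j| := by
  rcases le_total i j with h | h
  · have e : indexDist i j = j.val - i.val := by
      have := Fin.le_def.1 h
      unfold indexDist
      omega
    rw [e, abs_sub_comm]
    exact (mul_gap_le hε i j h).trans (le_abs_self _)
  · have e : indexDist i j = i.val - j.val := by
      have := Fin.le_def.1 h
      unfold indexDist
      omega
    rw [e]
    exact (mul_gap_le hε j i h).trans (le_abs_self _)

/-- The unknown urn fails to beat an urn at distance `d` in the order with probability at most
`η ^ (3 d)`, so that the union bound over all urns is a geometric series, and is independent of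
`n`. -/
theorem one_sub_le_isWinner {n : ℕ} {p : Fin n → unitInterval} {ε : ℝ} (hp : StrictMono p)
    (hε : IsMinGap p ε) (σ : SymmetricScheme n)
    (hσ : ∀ u j : Fin n, j ≠ u → 1 / 2 + |(p u : ℝ) - p j| / 4
      ≤ (ballotLaw σ (p u)).toMeasure.real {π | π j < π u})
    {η : ℝ} (h0 : 0 < η) (h1 : η ≤ 1 / 2) {m : ℕ}
    (hm : 24 * (Real.log (1 / η) / ε ^ 2) ≤ (m : ℝ)) (u : Fin n) :
    1 - η ≤ (electionLaw σ (p u) m).real {v | IsWinner v u} := by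
  have hε0 : 0 < ε := by
    obtain ⟨i, j, hij, rfl⟩ := hε.1
    exact sub_pos.2 (hp (Fin.lt_def.2 (by omega)))
  have hlose : ∀ j ∈ Finset.univ.erase u,
      (electionLaw σ (p u) m).real {v | ¬ Beats v u j} ≤ (η ^ 3) ^ indexDist u j := by
    intro j hj
    have hju : j ≠ u := Finset.ne_of_mem_erase hj
    have hd1 : 1 ≤ indexDist u j := by
      have := Fin.val_ne_of_ne hju
      unfold indexDist
      omega
    have hd : (1 : ℝ) ≤ indexDist u j := by exact_mod_cast hd1
    have hgap := indexDist_mul_le hε u j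
    have hbias : 1 / 2 + (indexDist u j : ℝ) * ε / 4
        ≤ (ballotLaw σ (p u)).toMeasure.real {π | π j < π u} := by
      have := hσ u j hju
      linarith
    have hH := measureReal_pi_card_le (ballotLaw σ (p u)).toMeasure
      (S := {π : Ballot n | π j < π u}) MeasurableSet.of_discrete m (by positivity) hbias
    have hset : {v : Fin m → Ballot n | ¬ Beats v u j}
        = {v | ((Finset.univ.filter fun t : Fin m =>
            v t ∈ {π : Ballot n | π j < π u}).card : ℝ) ≤ (m : ℝ) / 2} := by
      ext v
      simp only [Beats, Set.mem_ofPred_eq, not_lt]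
    rw [hset]
    refine hH.trans ?_
    have hL : 0 ≤ Real.log (1 / η) := by
      apply Real.log_nonneg
      rw [le_div_iff₀ h0]
      linarith
    have hmε : 24 * Real.log (1 / η) ≤ m * ε ^ 2 := by
      rw [← mul_div_assoc, div_le_iff₀ (by positivity)] at hm
      exact hm
    have hexp : (η ^ 3) ^ indexDist u j
        = Real.exp (-(3 * indexDist u j * Real.log (1 / η))) := by
      rw [← pow_mul, ← Real.rpow_natCast, Real.rpow_def_of_pos h0, one_div, Real.log_inv]
      congr 1
      push_cast
      ring
    rw [hexp]
    refine Real.exp_le_exp.2 (neg_le_neg ?_)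
    -- the constant `24 = 3 * 8`: Hoeffding's exponent `2 m (d ε / 4) ^ 2` has to reach
    -- `3 d log (1 / η)`
    calc 3 * (indexDist u j : ℝ) * Real.log (1 / η)
        = (indexDist u j : ℝ) / 8 * (24 * Real.log (1 / η)) := by ring
      _ ≤ (indexDist u j : ℝ) / 8 * (m * ε ^ 2) := by gcongr
      _ ≤ (indexDist u j : ℝ) / 8 * (m * ε ^ 2) * indexDist u j :=
          le_mul_of_one_le_right (by positivity) hd
      _ = 2 * m * ((indexDist u j : ℝ) * ε / 4) ^ 2 := by ring
  have hprob : IsProbabilityMeasure (electionLaw σ (p u) m) := by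
    unfold electionLaw
    infer_instance
  have hcompl : {v : Fin m → Ballot n | IsWinner v u}ᶜ
      ⊆ ⋃ j ∈ Finset.univ.erase u, {v | ¬ Beats v u j} := by
    intro v hv
    simp only [Set.mem_compl_iff, Set.mem_ofPred_eq, IsWinner, not_forall] at hv
    obtain ⟨j, hj, hb⟩ := hv
    simp only [Set.mem_iUnion]
    exact ⟨j, by simpa using hj, hb⟩
  have hbound : (electionLaw σ (p u) m).real {v : Fin m → Ballot n | IsWinner v u}ᶜ ≤ η := by
    have hη3 : η ^ 3 < 1 := pow_lt_one₀ h0.le (by linarith) (by norm_num)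
    refine (measureReal_mono hcompl (measure_ne_top _ _)).trans
      ((measureReal_biUnion_finset_le _ _).trans
      ((Finset.sum_le_sum hlose).trans
        ((sum_pow_indexDist_le u (by positivity) hη3).trans ?_)))
    -- `2 η³ / (1 - η³) ≤ η` for `η ≤ 1/2`
    rw [← mul_div_assoc, div_le_iff₀ (by linarith)]
    have hη2 : η ^ 2 ≤ 1 / 4 := by nlinarith
    have hη3' : η ^ 3 ≤ 1 / 2 := by nlinarith
    nlinarith
  rw [probReal_compl_eq_one_sub (Set.toFinite _).measurableSet] at hbound
  linarith

end Condorcet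

theorem mainTheorem6 (hconj : Condorcet.Conjecture) :
    (∀ (n : ℕ) (p : Fin n → unitInterval), StrictMono p →
      ∃ μ : PMF (Equiv.Perm (Fin n)), ∀ i j : Fin n, i < j →
        (μ.toMeasure {π | π i < π j}).toReal = min 1 (1 / ((p i : ℝ) + (p j : ℝ)))) ∧
    (∃ C : ℝ, 0 < C ∧
      ∀ (n : ℕ) (p : Fin n → unitInterval) (ε : ℝ), StrictMono p → Condorcet.IsMinGap p ε →
        ∃ σ : Condorcet.SymmetricScheme n,
          ∀ η : ℝ, 0 < η → η ≤ 1 / 2 →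
            ∀ m : ℕ, C * (Real.log (1 / η) / ε ^ 2) ≤ (m : ℝ) →
              ∀ u : Fin n,
                1 - η ≤ (Condorcet.electionLaw σ (p u) m).real
                  {v | Condorcet.IsWinner v u}) := by
  refine ⟨fun n p hp => Condorcet.exists_pmf_lt_eq hconj p hp, 24, by norm_num,
    fun n p ε hp hε => ?_⟩
  obtain ⟨σ, hσ⟩ := Condorcet.exists_scheme hconj p hp
  exact ⟨σ, fun η h0 h1 m hm u => Condorcet.one_sub_le_isWinner hp hε σ hσ h0 h1 hm u⟩
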